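/- For a nonempty compact convex set $S\subset\mathbb{R}^2$ and a point $P\notin S$, the angle of sight of $S$ at $P$ is the opening angle of the cone at $P$ formed by the union of all rays $PQ$, $Q\in S$. Fix a circle $C$ with center $O$ and an angle $\alpha\in(0,\pi)$. There is a nonempty compact convex set $S$ contained in the open disk bounded by $C$, not a disk centered at $O$, whose angle of sight from every point of $C$ equals $\alpha$, if and only if $\alpha=\frac{p}{q}\pi$ for some coprime positive integers $p<q$ with $q-p$ odd. In that case there are uncountably many such sets $S$. -/

import Mathlib

/-- The cone at `P` spanned by `S`: the union of all (closed) rays from `P` through points of `S`. -/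
def sightCone (S : Set (EuclideanSpace ℝ (Fin 2))) (P : EuclideanSpace ℝ (Fin 2)) :
    Set (EuclideanSpace ℝ (Fin 2)) :=
  {X | ∃ Q ∈ S, ∃ t : ℝ, 0 ≤ t ∧ X = P + t • (Q - P)}

/-- The angle of sight of `S` at a point `P ∉ S`: the opening angle of the cone at `P` spanned by
`S`, i.e. the largest angle between two rays of that cone. -/
noncomputable def angleOfSight (S : Set (EuclideanSpace ℝ (Fin 2)))
    (P : EuclideanSpace ℝ (Fin 2)) : ℝ :=
  sSup {θ : ℝ | ∃ X ∈ sightCone S P, ∃ Y ∈ sightCone S P,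
    X ≠ P ∧ Y ≠ P ∧ θ = EuclideanGeometry.angle X P Y}

/-- `S` is a compact convex shape lying strictly inside the circle `C` with center `O` and
radius `r`, whose angle of sight from every point of `C` is `α`. -/
structure IsConstantAngleShape (O : EuclideanSpace ℝ (Fin 2)) (r α : ℝ)
    (S : Set (EuclideanSpace ℝ (Fin 2))) : Prop where
  nonempty : S.Nonempty
  isCompact : IsCompact S
  convex : Convex ℝ S
  inside : S ⊆ Metric.ball O r
  angle_eq : ∀ P ∈ Metric.sphere O r, angleOfSight S P = α

/-- The constant angle shapes other than the disks centered at `O`. -/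
def nonDiskConstantAngleShapes (O : EuclideanSpace ℝ (Fin 2)) (r α : ℝ) :
    Set (Set (EuclideanSpace ℝ (Fin 2))) :=
  {S | IsConstantAngleShape O r α S ∧ ∀ ρ : ℝ, S ≠ Metric.closedBall O ρ}

/-- `α = (p/q) π` with `p < q` coprime positive integers and `q - p` odd. -/
def IsOddDifferenceAngle (α : ℝ) : Prop :=
  ∃ p q : ℕ, 0 < p ∧ p < q ∧ Nat.Coprime p q ∧ Odd (q - p) ∧ α = (p : ℝ) / (q : ℝ) * Real.pi

/-! Measure `S` by its support function about `O`, written `h θ = r cos (φ θ)` with `φ` valued in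
`(0, π)`: the support line with normal `dir θ` meets `C` at the polar angles `θ ± φ θ`. Seen from
the point at `θ + φ θ`, the sight angle is `α` exactly when the second tangent has its normal turned
by `π - α`, so the constant angle condition becomes `φ θ + φ (θ + (π - α)) = π - α` (`support_step`,
`isConstantAngleShape_of_isSupportFunction`).

Thus `ψ = φ - (π - α) / 2` is continuous, `2π`-periodic and `(π - α)`-antiperiodic. Such a `ψ`
vanishes unless `α = (p / q) π` in lowest terms with `q - p` odd, and `ψ = 0` makes `h` constant and
`S` a disk. In the remaining case `ψ = ε cos (q θ)` is admissible. For small `ε > 0` the resulting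
`h` satisfies `h + h'' ≥ 0`, hence is the support function of a convex set, and distinct `ε` give
distinct sets. -/

/-! ### Polar coordinates and the angle of sight. -/

open Real in
/-- The unit vector of the plane in direction `θ`. -/
noncomputable def dir (θ : ℝ) : EuclideanSpace ℝ (Fin 2) := !₂[cos θ, sin θ]

theorem inner_dir_right (v : EuclideanSpace ℝ (Fin 2)) (θ : ℝ) :
    inner ℝ v (dir θ) = v 0 * Real.cos θ + v 1 * Real.sin θ := by
  simp [dir, PiLp.inner_apply, Fin.sum_univ_two, mul_comm]

theorem inner_dir_dir (a b : ℝ) : inner ℝ (dir a) (dir b) = Real.cos (a - b) := by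
  rw [inner_dir_right, Real.cos_sub]; simp [dir]

theorem norm_dir (a : ℝ) : ‖dir a‖ = 1 := by
  have h := real_inner_self_eq_norm_sq (dir a)
  rw [inner_dir_dir, sub_self, Real.cos_zero] at h
  nlinarith [norm_nonneg (dir a)]

theorem continuous_dir : Continuous dir := by
  unfold dir
  refine (PiLp.continuous_toLp 2 _).comp (continuous_pi fun i => ?_)
  fin_cases i <;> simp <;> fun_prop

theorem dir_add_two_pi (θ : ℝ) : dir (θ + 2 * Real.pi) = dir θ := by
  simp [dir]

/-- A closed half-plane is swept by turning clockwise through `π` from one of its boundary rays. The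
angle `γ` then serves as a single-valued coordinate on `S`, seen from a point of a support line. -/
theorem exists_polar_of_inner_nonpos {v : EuclideanSpace ℝ (Fin 2)} (hv : v ≠ 0) {θ : ℝ}
    (h : inner ℝ v (dir θ) ≤ 0) :
    ∃ s > (0 : ℝ), ∃ γ ∈ Set.Icc 0 Real.pi, v = s • dir (θ - Real.pi / 2 - γ) := by
  have hs : 0 < ‖v‖ := norm_pos_iff.2 hv
  rw [inner_dir_right] at h
  have hn : ‖v‖ ^ 2 = v 0 ^ 2 + v 1 ^ 2 := by
    rw [EuclideanSpace.norm_sq_eq]; simp [Fin.sum_univ_two]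
  have hsc := Real.sin_sq_add_cos_sq θ
  set c := Real.cos θ with hc
  set d := Real.sin θ with hd
  have hxy : (v 0 * d - v 1 * c) ^ 2 + (v 0 * c + v 1 * d) ^ 2 = ‖v‖ ^ 2 := by
    rw [hn]; linear_combination (v 0 ^ 2 + v 1 ^ 2) * hsc
  have hle : |v 0 * d - v 1 * c| ≤ ‖v‖ := abs_le_of_sq_le_sq (by nlinarith) hs.le
  obtain ⟨hl, hu⟩ := abs_le.1 hle
  refine ⟨‖v‖, hs, Real.arccos ((v 0 * d - v 1 * c) / ‖v‖),
    ⟨Real.arccos_nonneg _, Real.arccos_le_pi _⟩, ?_⟩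
  have hcos := Real.cos_arccos (x := (v 0 * d - v 1 * c) / ‖v‖)
    (by rw [le_div_iff₀ hs]; linarith) (by rw [div_le_iff₀ hs]; linarith)
  have hsin : Real.sin (Real.arccos ((v 0 * d - v 1 * c) / ‖v‖)) = -(v 0 * c + v 1 * d) / ‖v‖ := by
    rw [Real.sin_arccos, ← Real.sqrt_sq (div_nonneg (by linarith) hs.le : 0 ≤ -(v 0 * c + v 1 * d) / ‖v‖)]
    congr 1
    field_simp
    linear_combination -hxy
  have e : θ - Real.pi / 2 - Real.arccos ((v 0 * d - v 1 * c) / ‖v‖) =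
    (θ - Real.arccos ((v 0 * d - v 1 * c) / ‖v‖)) - Real.pi / 2 := by ring
  rw [e]
  ext i
  fin_cases i
  · simp only [dir, Fin.zero_eta, PiLp.smul_apply, smul_eq_mul, Matrix.cons_val_zero,
      Real.cos_sub_pi_div_two, Real.sin_sub, hcos, hsin, ← hc, ← hd]
    field_simp
    linear_combination (-v 0) * hsc
  · simp only [dir, Fin.mk_one, PiLp.smul_apply, smul_eq_mul, Matrix.cons_val_one,
      Real.sin_sub_pi_div_two, Real.cos_sub, hcos, hsin, ← hc, ← hd]
    simp only [Matrix.cons_val_fin_one]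
    field_simp
    linear_combination (-v 1) * hsc

theorem exists_polar {v : EuclideanSpace ℝ (Fin 2)} (hv : v ≠ 0) :
    ∃ s > (0 : ℝ), ∃ θ, v = s • dir θ := by
  rcases le_total (inner ℝ v (dir 0)) 0 with h | h
  · obtain ⟨s, hs, γ, -, e⟩ := exists_polar_of_inner_nonpos hv h
    exact ⟨s, hs, _, e⟩
  · have h' : inner ℝ v (dir Real.pi) ≤ 0 := by
      rw [inner_dir_right] at h ⊢
      simp at h ⊢
      exact h
    obtain ⟨s, hs, γ, -, e⟩ := exists_polar_of_inner_nonpos hv h'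
    exact ⟨s, hs, _, e⟩

theorem angle_smul_dir {s t : ℝ} (hs : 0 < s) (ht : 0 < t) (a b : ℝ) (h : |a - b| ≤ Real.pi) :
    InnerProductGeometry.angle (s • dir a) (t • dir b) = |a - b| := by
  rw [InnerProductGeometry.angle_smul_left_of_pos _ _ hs,
    InnerProductGeometry.angle_smul_right_of_pos _ _ ht, InnerProductGeometry.angle,
    inner_dir_dir, norm_dir, norm_dir, mul_one, div_one, ← Real.cos_abs,
    Real.arccos_cos (abs_nonneg _) h]

theorem mem_sightCone {S : Set (EuclideanSpace ℝ (Fin 2))} {P Q : EuclideanSpace ℝ (Fin 2)}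
    (h : Q ∈ S) : Q ∈ sightCone S P :=
  ⟨Q, h, 1, zero_le_one, by simp⟩

theorem angleOfSight_eq_of_polar {S : Set (EuclideanSpace ℝ (Fin 2))}
    {P : EuclideanSpace ℝ (Fin 2)} {ω δ : ℝ} (hδ : δ ≤ Real.pi)
    (hS : ∀ Q ∈ S, ∃ s > (0 : ℝ), ∃ γ ∈ Set.Icc 0 δ, Q - P = s • dir (ω - γ))
    (h0 : ∃ Q ∈ S, ∃ s > (0 : ℝ), Q - P = s • dir ω)
    (h1 : ∃ Q ∈ S, ∃ s > (0 : ℝ), Q - P = s • dir (ω - δ)) :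
    angleOfSight S P = δ := by
  obtain ⟨Q₀, hQ₀, s₀, hs₀, e₀⟩ := h0
  obtain ⟨Q₁, hQ₁, s₁, hs₁, e₁⟩ := h1
  have hδ0 : 0 ≤ δ := by
    obtain ⟨s, -, γ, hγ, -⟩ := hS Q₀ hQ₀
    exact hγ.1.trans hγ.2
  have hne : ∀ Q ∈ S, Q ≠ P := by
    rintro Q hQ rfl
    obtain ⟨s, hs, γ, -, e⟩ := hS Q hQ
    have := congrArg norm e
    rw [sub_self, norm_zero, norm_smul, norm_dir, mul_one, Real.norm_of_nonneg hs.le] at this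
    exact hs.ne this
  have hcone : ∀ X ∈ sightCone S P, X ≠ P →
      ∃ s > (0 : ℝ), ∃ γ ∈ Set.Icc 0 δ, X - P = s • dir (ω - γ) := by
    rintro X ⟨Q, hQ, t, ht, rfl⟩ hX
    obtain ⟨s, hs, γ, hγ, e⟩ := hS Q hQ
    have ht' : 0 < t := ht.lt_of_ne (by rintro rfl; simp at hX)
    exact ⟨t * s, mul_pos ht' hs, γ, hγ, by rw [add_sub_cancel_left, e, smul_smul]⟩
  refine IsGreatest.csSup_eq ⟨⟨Q₀, mem_sightCone hQ₀, Q₁, mem_sightCone hQ₁, hne _ hQ₀, hne _ hQ₁,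
    ?_⟩, ?_⟩
  · rw [EuclideanGeometry.angle, vsub_eq_sub, vsub_eq_sub, e₀, e₁, angle_smul_dir hs₀ hs₁]
    · rw [sub_sub_cancel, abs_of_nonneg hδ0]
    · rwa [sub_sub_cancel, abs_of_nonneg hδ0]
  · rintro _ ⟨X, hX, Y, hY, hXP, hYP, rfl⟩
    obtain ⟨s, hs, γ, hγ, e⟩ := hcone X hX hXP
    obtain ⟨t, ht, γ', hγ', e'⟩ := hcone Y hY hYP
    have hle : |ω - γ - (ω - γ')| ≤ δ := by
      rw [abs_le]; constructor <;> linarith [hγ.1, hγ.2, hγ'.1, hγ'.2]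
    rw [EuclideanGeometry.angle, vsub_eq_sub, vsub_eq_sub, e, e',
      angle_smul_dir hs ht _ _ (hle.trans hδ)]
    exact hle

/-! ### Support lines through points of the circle. -/

/-- `h` is the support function of `S` with respect to the origin `O`. -/
def IsSupportFunction (O : EuclideanSpace ℝ (Fin 2)) (S : Set (EuclideanSpace ℝ (Fin 2)))
    (h : ℝ → ℝ) : Prop :=
  ∀ θ, IsGreatest ((fun x => inner ℝ (x - O) (dir θ)) '' S) (h θ)

theorem inner_sub_neg_of_mem_ball {O P Q : EuclideanSpace ℝ (Fin 2)} {r : ℝ}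
    (hQ : Q ∈ Metric.ball O r) (hP : P ∈ Metric.sphere O r) : inner ℝ (Q - P) (P - O) < 0 := by
  rw [mem_ball_iff_norm] at hQ
  rw [mem_sphere_iff_norm] at hP
  have e : Q - P = (Q - O) - (P - O) := by abel
  rw [e, inner_sub_left, real_inner_self_eq_norm_sq, hP]
  have := real_inner_le_norm (Q - O) (P - O)
  rw [hP] at this
  nlinarith [norm_nonneg (Q - O)]

theorem add_smul_dir_mem_sphere (O : EuclideanSpace ℝ (Fin 2)) {r : ℝ} (hr : 0 ≤ r) (t : ℝ) :
    O + r • dir t ∈ Metric.sphere O r := by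
  rw [mem_sphere_iff_norm, add_sub_cancel_left, norm_smul, norm_dir, mul_one,
    Real.norm_of_nonneg hr]

/-- The point `O + r • dir (θ + w)` lies on the support line with normal `dir θ`, and the contact
point is seen from it in the direction `θ - π / 2`. -/
theorem exists_polar_of_support_line {O : EuclideanSpace ℝ (Fin 2)} {r : ℝ} (hr : 0 < r)
    {S : Set (EuclideanSpace ℝ (Fin 2))} (hS : S ⊆ Metric.ball O r) {θ w : ℝ}
    (hw : w ∈ Set.Ioo 0 Real.pi)
    (h : IsGreatest ((fun x => inner ℝ (x - O) (dir θ)) '' S) (r * Real.cos w)) :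
    (∀ Q ∈ S, ∃ s > (0 : ℝ), ∃ γ ∈ Set.Icc 0 Real.pi,
      Q - (O + r • dir (θ + w)) = s • dir (θ - Real.pi / 2 - γ)) ∧
    ∃ Q ∈ S, ∃ s > (0 : ℝ), Q - (O + r • dir (θ + w)) = s • dir (θ - Real.pi / 2) := by
  have hP := add_smul_dir_mem_sphere O hr.le (θ + w)
  set P := O + r • dir (θ + w) with hPdef
  have hPO : P - O = r • dir (θ + w) := by rw [hPdef, add_sub_cancel_left]
  have hPθ : inner ℝ (P - O) (dir θ) = r * Real.cos w := by
    rw [hPO, real_inner_smul_left, inner_dir_dir, add_sub_cancel_left]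
  have hne : ∀ Q ∈ S, Q - P ≠ 0 := by
    intro Q hQ h0
    have := inner_sub_neg_of_mem_ball (hS hQ) hP
    rw [h0, inner_zero_left] at this
    exact this.false
  have hsub : ∀ Q, inner ℝ (Q - P) (dir θ) = inner ℝ (Q - O) (dir θ) - r * Real.cos w := by
    intro Q
    rw [← hPθ, ← inner_sub_left, sub_sub_sub_cancel_right]
  have key : ∀ Q ∈ S, ∃ s > (0 : ℝ), ∃ γ ∈ Set.Icc 0 Real.pi,
      Q - P = s • dir (θ - Real.pi / 2 - γ) := by
    intro Q hQ
    refine exists_polar_of_inner_nonpos (hne Q hQ) ?_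
    rw [hsub]
    have := h.2 ⟨Q, hQ, rfl⟩
    simp only at this
    linarith
  refine ⟨key, ?_⟩
  obtain ⟨Q, hQ, eQ⟩ := h.1
  obtain ⟨s, hs, γ, hγ, e⟩ := key Q hQ
  have h0 : inner ℝ (Q - P) (dir θ) = 0 := by rw [hsub]; simp only at eQ; linarith
  have hsin : Real.sin γ = 0 := by
    rw [e, real_inner_smul_left, inner_dir_dir, mul_eq_zero, or_iff_right hs.ne',
      show θ - Real.pi / 2 - γ - θ = -(γ + Real.pi / 2) by ring, Real.cos_neg,
      Real.cos_add_pi_div_two] at h0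
    linarith
  -- The contact point lies on the support line, so `γ` is `0` or `π`; the value `π` points out of
  -- the circle because `sin w > 0`.
  have hγ0 : γ = 0 := by
    by_contra hne0
    have hγpos : 0 < γ := hγ.1.lt_of_ne (Ne.symm hne0)
    have hγπ : γ = Real.pi := by
      by_contra hneπ
      exact (Real.sin_pos_of_pos_of_lt_pi hγpos (hγ.2.lt_of_ne hneπ)).ne' hsin
    have hneg := inner_sub_neg_of_mem_ball (hS hQ) hP
    rw [e, hPO, real_inner_smul_left, real_inner_smul_right, inner_dir_dir, hγπ,
      show θ - Real.pi / 2 - Real.pi - (θ + w) = (-(w + Real.pi / 2)) - Real.pi by ring,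
      Real.cos_sub_pi, Real.cos_neg, Real.cos_add_pi_div_two, neg_neg] at hneg
    have := Real.sin_pos_of_pos_of_lt_pi hw.1 hw.2
    have := mul_pos hs (mul_pos hr this)
    linarith
  exact ⟨Q, hQ, s, hs, by rw [e, hγ0, sub_zero]⟩

/-- Two support lines meeting on the circle determine the angle of sight. -/
theorem angleOfSight_eq_of_support {O : EuclideanSpace ℝ (Fin 2)} {r : ℝ} (hr : 0 < r)
    {S : Set (EuclideanSpace ℝ (Fin 2))} (hS : S ⊆ Metric.ball O r) {θ w w' : ℝ}
    (hw : 0 < w) (hw' : 0 < w') (hww : w + w' < Real.pi)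
    (h : IsGreatest ((fun x => inner ℝ (x - O) (dir θ)) '' S) (r * Real.cos w))
    (h' : IsGreatest ((fun x => inner ℝ (x - O) (dir (θ + (w + w')))) '' S) (r * Real.cos w')) :
    angleOfSight S (O + r • dir (θ + w)) = Real.pi - (w + w') := by
  obtain ⟨key, hcontact⟩ := exists_polar_of_support_line hr hS ⟨hw, by linarith⟩ h
  set P := O + r • dir (θ + w) with hPdef
  set β := w + w' with hβ
  have hPβ : inner ℝ (P - O) (dir (θ + β)) = r * Real.cos w' := by
    rw [hPdef, add_sub_cancel_left, real_inner_smul_left, inner_dir_dir,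
      show θ + w - (θ + β) = -w' by rw [hβ]; ring, Real.cos_neg]
  have hsub : ∀ Q, inner ℝ (Q - P) (dir (θ + β)) =
      inner ℝ (Q - O) (dir (θ + β)) - r * Real.cos w' := by
    intro Q
    rw [← hPβ, ← inner_sub_left, sub_sub_sub_cancel_right]
  have hdir : ∀ s γ : ℝ, inner ℝ (s • dir (θ - Real.pi / 2 - γ)) (dir (θ + β)) =
      -(s * Real.sin (γ + β)) := by
    intro s γ
    rw [real_inner_smul_left, inner_dir_dir,
      show θ - Real.pi / 2 - γ - (θ + β) = -((γ + β) + Real.pi / 2) by ring, Real.cos_neg,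
      Real.cos_add_pi_div_two, mul_neg]
  have hbound : ∀ s > (0 : ℝ), ∀ γ ∈ Set.Icc 0 Real.pi, 0 ≤ s * Real.sin (γ + β) → γ ≤ Real.pi - β := by
    intro s hs γ hγ h0
    by_contra! hlt
    have h1 : 0 < Real.sin (γ + β - Real.pi) :=
      Real.sin_pos_of_pos_of_lt_pi (by linarith) (by linarith [hγ.2])
    rw [Real.sin_sub_pi] at h1
    nlinarith
  refine angleOfSight_eq_of_polar (ω := θ - Real.pi / 2) (by linarith) ?_ hcontact ?_
  · intro Q hQ
    obtain ⟨s, hs, γ, hγ, e⟩ := key Q hQ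
    refine ⟨s, hs, γ, ⟨hγ.1, hbound s hs γ hγ ?_⟩, e⟩
    have h1 := hsub Q
    have h2 := h'.2 ⟨Q, hQ, rfl⟩
    simp only at h2
    rw [e, hdir] at h1
    linarith
  · obtain ⟨Q, hQ, eQ⟩ := h'.1
    obtain ⟨s, hs, γ, hγ, e⟩ := key Q hQ
    have h1 := hsub Q
    simp only at eQ
    rw [e, hdir, eQ, sub_self, neg_eq_zero] at h1
    have hle := hbound s hs γ hγ h1.ge
    have hge : Real.pi - β ≤ γ := by
      by_contra! hlt
      exact (mul_pos hs (Real.sin_pos_of_pos_of_lt_pi (by linarith [hγ.1]) (by linarith))).ne' h1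
    exact ⟨Q, hQ, s, hs, by rw [e, le_antisymm hle hge]⟩

/-- If the angle of sight from the far end of a support line is `α`, then the other support line
through that point is the one whose normal is turned by `π - α`. -/
theorem support_step {O : EuclideanSpace ℝ (Fin 2)} {r α : ℝ} (hr : 0 < r) (hα : 0 < α)
    (hαpi : α < Real.pi)
    {S : Set (EuclideanSpace ℝ (Fin 2))} (hS : S ⊆ Metric.ball O r) (hc : IsCompact S)
    {θ w w' : ℝ} (hw : w ∈ Set.Ioo 0 Real.pi) (hw' : w' ∈ Set.Ioo 0 Real.pi)
    (h : IsGreatest ((fun x => inner ℝ (x - O) (dir θ)) '' S) (r * Real.cos w))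
    (h' : IsGreatest ((fun x => inner ℝ (x - O) (dir (θ + (Real.pi - α)))) '' S)
      (r * Real.cos w'))
    (hangle : angleOfSight S (O + r • dir (θ + w)) = α) :
    w + w' = Real.pi - α := by
  obtain ⟨key, Q₀, hQ₀, s₀, hs₀, e₀⟩ := exists_polar_of_support_line hr hS hw h
  have hP := add_smul_dir_mem_sphere O hr.le (θ + w)
  set P := O + r • dir (θ + w) with hPdef
  have hPO : P - O = r • dir (θ + w) := by rw [hPdef, add_sub_cancel_left]
  have hne : ∀ Q ∈ S, Q ≠ P := by
    rintro Q hQ rfl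
    have := inner_sub_neg_of_mem_ball (hS hQ) hP
    rw [sub_self, inner_zero_left] at this
    exact this.false
  have hang : ∀ Q, ∀ s > (0 : ℝ), ∀ γ ∈ Set.Icc 0 Real.pi, Q - P = s • dir (θ - Real.pi / 2 - γ) →
      EuclideanGeometry.angle Q₀ P Q = γ := by
    intro Q s hs γ hγ e
    rw [EuclideanGeometry.angle, vsub_eq_sub, vsub_eq_sub, e, e₀, angle_smul_dir hs₀ hs]
    · rw [sub_sub_cancel, abs_of_nonneg hγ.1]
    · rw [sub_sub_cancel, abs_of_nonneg hγ.1]; exact hγ.2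
  have hcont : ContinuousOn (fun Q => EuclideanGeometry.angle Q₀ P Q) S := by
    intro Q hQ
    have := (EuclideanGeometry.continuousAt_angle (x := (Q₀, P, Q)) (hne _ hQ₀) (hne _ hQ))
    exact (this.comp (f := fun Q => (Q₀, P, Q)) (by fun_prop)).continuousWithinAt
  -- The point seen farthest from `Q₀` lies on the second tangent from `P`, so its angle is the
  -- whole angle of sight.
  obtain ⟨Q₁, hQ₁, hmax⟩ := hc.exists_isMaxOn ⟨Q₀, hQ₀⟩ hcont
  obtain ⟨s₁, hs₁, γ₁, hγ₁, e₁⟩ := key Q₁ hQ₁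
  have hle : ∀ Q ∈ S, ∃ s > (0 : ℝ), ∃ γ ∈ Set.Icc 0 γ₁, Q - P = s • dir (θ - Real.pi / 2 - γ) := by
    intro Q hQ
    obtain ⟨s, hs, γ, hγ, e⟩ := key Q hQ
    refine ⟨s, hs, γ, ⟨hγ.1, ?_⟩, e⟩
    have := hmax hQ
    simp only [Set.mem_ofPred_eq] at this
    rwa [hang Q s hs γ hγ e, hang Q₁ s₁ hs₁ γ₁ hγ₁ e₁] at this
  have hγα : γ₁ = α := by
    rw [← hangle]
    exact (angleOfSight_eq_of_polar hγ₁.2 hle ⟨Q₀, hQ₀, s₀, hs₀, e₀⟩ ⟨Q₁, hQ₁, s₁, hs₁, e₁⟩).symm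
  subst hγα
  have hdir : ∀ s γ : ℝ, inner ℝ (s • dir (θ - Real.pi / 2 - γ)) (dir (θ + (Real.pi - γ₁))) =
      s * Real.sin (γ - γ₁) := by
    intro s γ
    rw [real_inner_smul_left, inner_dir_dir,
      show θ - Real.pi / 2 - γ - (θ + (Real.pi - γ₁)) =
        -(((γ - γ₁) + Real.pi) + Real.pi / 2) by ring, Real.cos_neg,
      Real.cos_add_pi_div_two, Real.sin_add_pi, neg_neg]
  have hPβ : inner ℝ (P - O) (dir (θ + (Real.pi - γ₁))) = r * Real.cos (w - (Real.pi - γ₁)) := by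
    rw [hPO, real_inner_smul_left, inner_dir_dir]; ring_nf
  have hsub : ∀ Q, inner ℝ (Q - O) (dir (θ + (Real.pi - γ₁))) =
      inner ℝ (Q - P) (dir (θ + (Real.pi - γ₁))) + r * Real.cos (w - (Real.pi - γ₁)) := by
    intro Q
    rw [← hPβ, ← inner_add_left, sub_add_sub_cancel]
  have hgreat : IsGreatest ((fun x => inner ℝ (x - O) (dir (θ + (Real.pi - γ₁)))) '' S)
      (r * Real.cos (w - (Real.pi - γ₁))) := by
    refine ⟨⟨Q₁, hQ₁, ?_⟩, ?_⟩
    · simp only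
      rw [hsub, e₁, hdir, sub_self, Real.sin_zero, mul_zero, zero_add]
    · rintro _ ⟨Q, hQ, rfl⟩
      obtain ⟨s, hs, γ, hγ, e⟩ := hle Q hQ
      simp only
      rw [hsub, e, hdir]
      have := Real.sin_nonpos_of_nonpos_of_neg_pi_le (x := γ - γ₁) (by linarith [hγ.2])
        (by linarith [hγ.1])
      nlinarith
  -- The cosine fixes `w - (π - α)` only up to sign. Since `Q₁` is inside the circle, the sign is
  -- negative.
  have hpos : 0 < Real.pi - γ₁ - w := by
    have hneg := inner_sub_neg_of_mem_ball (hS hQ₁) hP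
    rw [e₁, hPO, real_inner_smul_left, real_inner_smul_right, inner_dir_dir,
      show θ - Real.pi / 2 - γ₁ - (θ + w) = (Real.pi - γ₁ - w) + Real.pi / 2 - 2 * Real.pi by ring,
      Real.cos_sub_two_pi, Real.cos_add_pi_div_two] at hneg
    by_contra! hle0
    have := Real.sin_nonpos_of_nonpos_of_neg_pi_le hle0 (by linarith [hw.2])
    have := mul_nonneg hs₁.le (mul_nonneg hr.le (neg_nonneg.2 this))
    linarith
  have hcos := mul_left_cancel₀ hr.ne' (h'.unique hgreat)
  rw [← Real.cos_neg (w - _), neg_sub] at hcos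
  have := Real.injOn_cos ⟨hw'.1.le, hw'.2.le⟩ ⟨hpos.le, by linarith [hw.1]⟩ hcos
  linarith

/-! ### Existence of the support function, and the disk case. -/

theorem exists_continuous_isSupportFunction (O : EuclideanSpace ℝ (Fin 2))
    {S : Set (EuclideanSpace ℝ (Fin 2))} (hne : S.Nonempty) (hc : IsCompact S) :
    ∃ h : ℝ → ℝ, Continuous h ∧ IsSupportFunction O S h := by
  have hcont := continuous_dir
  refine ⟨fun θ => sSup ((fun x => inner ℝ (x - O) (dir θ)) '' S), ?_, fun θ => ?_⟩
  · refine hc.continuous_sSup (f := fun θ x => inner ℝ (x - O) (dir θ)) ?_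
    exact (continuous_snd.sub continuous_const).inner (hcont.comp continuous_fst)
  · exact (hc.image (by fun_prop)).isGreatest_sSup (hne.image _)

theorem abs_inner_dir_lt {O x : EuclideanSpace ℝ (Fin 2)} {r : ℝ} (hx : x ∈ Metric.ball O r)
    (θ : ℝ) : |inner ℝ (x - O) (dir θ)| < r := by
  rw [mem_ball_iff_norm] at hx
  have := abs_real_inner_le_norm (x - O) (dir θ)
  rw [norm_dir, mul_one] at this
  exact this.trans_lt hx

theorem eq_closedBall_of_isSupportFunction_const {O : EuclideanSpace ℝ (Fin 2)}
    {S : Set (EuclideanSpace ℝ (Fin 2))} (hc : IsCompact S) (hconv : Convex ℝ S) {ρ : ℝ}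
    (hρ : 0 ≤ ρ) (h : IsSupportFunction O S fun _ => ρ) : S = Metric.closedBall O ρ := by
  apply Set.Subset.antisymm
  · intro x hx
    rw [mem_closedBall_iff_norm]
    by_cases hv : x - O = 0
    · rwa [hv, norm_zero]
    obtain ⟨s, hs, θ, e⟩ := exists_polar hv
    have h1 := (h θ).2 ⟨x, hx, rfl⟩
    simp only [e, real_inner_smul_left, inner_dir_dir, sub_self, Real.cos_zero, mul_one] at h1
    rwa [e, norm_smul, norm_dir, mul_one, Real.norm_of_nonneg hs.le]
  · intro x hx
    rw [mem_closedBall_iff_norm] at hx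
    by_contra hxS
    obtain ⟨f, u, hfu, hux⟩ := geometric_hahn_banach_closed_point hconv hc.isClosed hxS
    set v := (InnerProductSpace.toDual ℝ (EuclideanSpace ℝ (Fin 2))).symm f with hv
    have hf : ∀ y, inner ℝ v y = f y := fun y => InnerProductSpace.toDual_symm_apply
    have hv0 : v ≠ 0 := by
      intro h0
      obtain ⟨Q, hQ, -⟩ := (h 0).1
      have h1 := hfu Q hQ
      rw [← hf, h0, inner_zero_left] at h1
      rw [← hf, h0, inner_zero_left] at hux
      linarith
    obtain ⟨s, hs, θ, e⟩ := exists_polar hv0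
    obtain ⟨Q, hQ, eQ⟩ := (h θ).1
    have h1 : inner ℝ v (Q - O) < inner ℝ v (x - O) := by
      rw [hf, hf, map_sub, map_sub]
      linarith [hfu Q hQ]
    rw [e, real_inner_smul_left, real_inner_smul_left, mul_lt_mul_iff_right₀ hs,
      real_inner_comm, real_inner_comm (x - O)] at h1
    have h2 := real_inner_le_norm (x - O) (dir θ)
    rw [norm_dir, mul_one] at h2
    simp only at eQ
    linarith

/-! ### Necessity of the arithmetic condition. -/

/-- It is enough that `π - α` is also a period. If `α / π` is irrational, the periods `2(π - α)` and
`2π` generate a dense group; otherwise an odd multiple of `π - α` is a multiple of `2π`. -/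
theorem Function.Antiperiodic.eq_zero_of_not_isOddDifferenceAngle {ψ : ℝ → ℝ} {α : ℝ}
    (hc : Continuous ψ) (hα : 0 < α) (hαpi : α < Real.pi) (hβ : Function.Antiperiodic ψ (Real.pi - α))
    (hp : Function.Periodic ψ (2 * Real.pi)) (hn : ¬ IsOddDifferenceAngle α) (θ : ℝ) :
    ψ θ = 0 := by
  have hπ := Real.pi_pos
  suffices h : ψ (θ + (Real.pi - α)) = ψ θ by
    have := hβ θ
    linarith
  by_cases hirr : Irrational (α / Real.pi)
  · have hirr' : Irrational (2 * (Real.pi - α) / (2 * Real.pi)) := by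
      have e : 2 * (Real.pi - α) / (2 * Real.pi) = (1 : ℕ) - α / Real.pi := by
        push_cast; field_simp
      rw [e]
      exact hirr.natCast_sub 1
    have hdense := dense_addSubgroupClosure_pair_iff.2 hirr'
    have hper : ∀ c ∈ AddSubgroup.closure {2 * (Real.pi - α), 2 * Real.pi},
        Function.Periodic ψ c := by
      intro c hc
      induction hc using AddSubgroup.closure_induction with
      | mem x hx =>
        rcases hx with rfl | rfl
        · exact hβ.periodic_two_mul
        · exact hp
      | zero => exact fun x => by rw [add_zero]
      | add x y _ _ hx hy => exact hx.add_period hy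
      | neg x _ hx => exact hx.neg
    have hclosed : IsClosed {c | ψ (θ + c) = ψ θ} :=
      isClosed_eq (by fun_prop) continuous_const
    have := hclosed.closure_subset_iff.2 (fun c hc => hper c hc θ) (hdense (Real.pi - α))
    exact this
  · obtain ⟨x, hx⟩ := not_not.1 hirr
    have hx0 : 0 < x := by
      have : (0 : ℝ) < x := by rw [hx]; positivity
      exact_mod_cast this
    have hx1 : x < 1 := by
      have : (x : ℝ) < 1 := by rw [hx, div_lt_one hπ]; exact hαpi
      exact_mod_cast this
    obtain ⟨p, hp'⟩ := Int.eq_ofNat_of_zero_le (Rat.num_pos.2 hx0).le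
    have hp0 : 0 < p := by have := Rat.num_pos.2 hx0; omega
    have hq0 := x.den_pos
    have hq : (0 : ℝ) < x.den := by exact_mod_cast hq0
    have hcop : Nat.Coprime p x.den := by
      have := x.reduced
      rwa [hp', Int.natAbs_natCast] at this
    have hlt : p < x.den := by
      have := Rat.num_lt_denom_iff.2 hx1
      omega
    have hxe : (x : ℝ) = p / x.den := by
      rw [Rat.cast_def, hp', Int.cast_natCast]
    have hαe : α = (p : ℝ) / x.den * Real.pi := by
      rw [← hxe, hx]; field_simp
    have heven : Even (x.den - p) := by
      rw [← Nat.not_odd_iff_even]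
      exact fun hodd => hn ⟨p, x.den, hp0, hlt, hcop, hodd, hαe⟩
    -- If the denominator were even, the numerator would be too, against coprimality.
    have hodd : Odd x.den := by
      rw [← Nat.not_even_iff_odd]
      intro he
      have hpe : Even p := by
        rw [Nat.even_sub hlt.le] at heven
        exact heven.1 he
      exact Nat.not_coprime_of_dvd_of_dvd one_lt_two hpe.two_dvd he.two_dvd hcop
    obtain ⟨k, hk⟩ := hodd
    obtain ⟨m, hm⟩ := heven
    have e : (k : ℝ) * (2 * (Real.pi - α)) + (Real.pi - α) = m * (2 * Real.pi) := by
      have h1 : (x.den : ℝ) = 2 * k + 1 := by exact_mod_cast hk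
      have h2 : (x.den : ℝ) = p + (m + m) := by
        have : x.den = p + (m + m) := by omega
        exact_mod_cast this
      have h3 : (x.den : ℝ) * α = p * Real.pi := by rw [hαe]; field_simp
      linear_combination (-(Real.pi - α)) * h1 + Real.pi * h2 - h3
    have h1 := hβ.nat_odd_mul_antiperiodic k θ
    rw [e, hp.nat_mul m θ] at h1
    rw [hβ θ]
    linarith

theorem IsConstantAngleShape.eq_closedBall {O : EuclideanSpace ℝ (Fin 2)} {r α : ℝ} (hr : 0 < r)
    (hα : 0 < α) (hαpi : α < Real.pi) {S : Set (EuclideanSpace ℝ (Fin 2))}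
    (hS : IsConstantAngleShape O r α S) (hn : ¬ IsOddDifferenceAngle α) :
    ∃ ρ, S = Metric.closedBall O ρ := by
  obtain ⟨h, hcont, hsupp⟩ := exists_continuous_isSupportFunction O hS.nonempty hS.isCompact
  have habs : ∀ θ, |h θ / r| < 1 := by
    intro θ
    obtain ⟨Q, hQ, e⟩ := (hsupp θ).1
    rw [abs_div, abs_of_pos hr, div_lt_one hr, ← e]
    exact abs_inner_dir_lt (hS.inside hQ) θ
  set φ : ℝ → ℝ := fun θ => Real.arccos (h θ / r) with hφ
  have hφmem : ∀ θ, φ θ ∈ Set.Ioo 0 Real.pi := by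
    intro θ
    obtain ⟨h1, h2⟩ := abs_lt.1 (habs θ)
    refine ⟨Real.arccos_pos.2 h2, (Real.arccos_le_pi _).lt_of_ne fun h3 => ?_⟩
    rw [Real.arccos_eq_pi] at h3
    linarith
  have hrφ : ∀ θ, r * Real.cos (φ θ) = h θ := by
    intro θ
    obtain ⟨h1, h2⟩ := abs_lt.1 (habs θ)
    rw [hφ, Real.cos_arccos h1.le h2.le, mul_div_cancel₀ _ hr.ne']
  have hstep : ∀ θ, φ θ + φ (θ + (Real.pi - α)) = Real.pi - α := by
    intro θ
    refine support_step hr hα hαpi hS.inside hS.isCompact (hφmem _) (hφmem _) ?_ ?_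
      (hS.angle_eq _ (add_smul_dir_mem_sphere O hr.le (θ + φ θ)))
    · rw [hrφ]; exact hsupp θ
    · rw [hrφ]; exact hsupp _
  have hper : Function.Periodic h (2 * Real.pi) := by
    intro θ
    refine (hsupp (θ + 2 * Real.pi)).unique ?_
    rw [dir_add_two_pi]
    exact hsupp θ
  have hzero := Function.Antiperiodic.eq_zero_of_not_isOddDifferenceAngle
    (ψ := fun θ => φ θ - (Real.pi - α) / 2) (by fun_prop) hα hαpi
    (fun θ => by linarith [hstep θ]) (fun θ => by simp only [hφ, hper θ]) hn
  refine ⟨r * Real.cos ((Real.pi - α) / 2), eq_closedBall_of_isSupportFunction_const hS.isCompact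
    hS.convex (mul_nonneg hr.le (Real.cos_nonneg_of_neg_pi_div_two_le_of_le ?_ ?_)) ?_⟩
  · linarith
  · linarith
  · intro θ
    have h1 : φ θ = (Real.pi - α) / 2 := by linarith [hzero θ]
    simp only
    rw [← h1, hrφ]
    exact hsupp θ

/-! ### From the functional equation to convex sets with prescribed support function. -/

theorem isConstantAngleShape_of_isSupportFunction {O : EuclideanSpace ℝ (Fin 2)} {r α : ℝ}
    (hr : 0 < r) (hα : 0 < α) {S : Set (EuclideanSpace ℝ (Fin 2))} (hc : IsCompact S)
    (hconv : Convex ℝ S) (hS : S ⊆ Metric.ball O r) {φ : ℝ → ℝ} (hcont : Continuous φ)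
    (hφ : ∀ θ, φ θ ∈ Set.Ioo 0 Real.pi)
    (hsupp : IsSupportFunction O S fun θ => r * Real.cos (φ θ))
    (hstep : ∀ θ, φ θ + φ (θ + (Real.pi - α)) = Real.pi - α) : IsConstantAngleShape O r α S := by
  refine ⟨Set.image_nonempty.1 ⟨_, (hsupp 0).1⟩, hc, hconv, hS, fun P hP => ?_⟩
  rw [mem_sphere_iff_norm] at hP
  obtain ⟨s, hs, t, e⟩ := exists_polar (v := P - O) (by rw [← norm_pos_iff, hP]; exact hr)
  rw [e, norm_smul, norm_dir, mul_one, Real.norm_of_nonneg hs.le] at hP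
  subst hP
  -- Every point of the circle is the far end of some support line, because `θ + φ θ` is continuous
  -- and stays within `(θ, θ + π)`.
  obtain ⟨θ, -, hθ⟩ := intermediate_value_Icc (f := fun θ => θ + φ θ)
    (by linarith [Real.pi_pos] : t - Real.pi ≤ t) (by fun_prop)
    (show t ∈ Set.Icc _ _ from ⟨by linarith [(hφ (t - Real.pi)).2], by linarith [(hφ t).1]⟩)
  have hPe : P = O + s • dir (θ + φ θ) := by
    simp only at hθ
    rw [hθ, ← e, add_sub_cancel]
  rw [hPe, angleOfSight_eq_of_support hr hS (hφ θ).1 (hφ (θ + (Real.pi - α))).1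
    (by linarith [hstep θ]) (hsupp θ) (by rw [hstep]; exact hsupp _), hstep]
  ring

/-- The intersection of the half-planes `⟪x - O, dir θ⟫ ≤ h θ`. -/
def wulffShape (O : EuclideanSpace ℝ (Fin 2)) (h : ℝ → ℝ) : Set (EuclideanSpace ℝ (Fin 2)) :=
  {x | ∀ θ, inner ℝ (x - O) (dir θ) ≤ h θ}

theorem convex_wulffShape (O : EuclideanSpace ℝ (Fin 2)) (h : ℝ → ℝ) :
    Convex ℝ (wulffShape O h) := by
  intro x hx y hy a b ha hb hab θ
  have e : a • x + b • y - O = a • (x - O) + b • (y - O) := by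
    rw [smul_sub, smul_sub, sub_add_sub_comm, ← add_smul, hab, one_smul]
  rw [e, inner_add_left, real_inner_smul_left, real_inner_smul_left]
  calc _ ≤ a * h θ + b * h θ := by gcongr; exacts [hx θ, hy θ]
    _ = h θ := by rw [← add_mul, hab, one_mul]

theorem wulffShape_subset_ball {O : EuclideanSpace ℝ (Fin 2)} {h : ℝ → ℝ} {r : ℝ} (hr : 0 < r)
    (hh : ∀ θ, h θ < r) : wulffShape O h ⊆ Metric.ball O r := by
  intro x hx
  rw [mem_ball_iff_norm]
  by_cases hv : x - O = 0
  · rwa [hv, norm_zero]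
  obtain ⟨s, hs, θ, e⟩ := exists_polar hv
  have h1 := hx θ
  rw [e, real_inner_smul_left, inner_dir_dir, sub_self, Real.cos_zero, mul_one] at h1
  rw [e, norm_smul, norm_dir, mul_one, Real.norm_of_nonneg hs.le]
  exact h1.trans_lt (hh θ)

theorem isClosed_wulffShape (O : EuclideanSpace ℝ (Fin 2)) (h : ℝ → ℝ) :
    IsClosed (wulffShape O h) := by
  have e : wulffShape O h = ⋂ θ, {x | inner ℝ (x - O) (dir θ) ≤ h θ} := by
    ext x; simp [wulffShape]
  rw [e]
  exact isClosed_iInter fun θ => isClosed_le (by fun_prop) continuous_const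

theorem isCompact_wulffShape {O : EuclideanSpace ℝ (Fin 2)} {h : ℝ → ℝ} {r : ℝ} (hr : 0 < r)
    (hh : ∀ θ, h θ < r) : IsCompact (wulffShape O h) :=
  Metric.isCompact_of_isClosed_isBounded (isClosed_wulffShape O h)
    (Metric.isBounded_ball.subset (wulffShape_subset_ball hr hh))

/-- Sturm comparison: if `h + h'' ≥ 0`, a `2π`-periodic `h` lies above the solutions of
`g + g'' = 0` that are tangent to it. -/
theorem mul_cos_add_mul_sin_le {h h' h'' : ℝ → ℝ} (hd : ∀ x, HasDerivAt h (h' x) x)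
    (hd' : ∀ x, HasDerivAt h' (h'' x) x) (hnn : ∀ x, 0 ≤ h x + h'' x)
    (hp : Function.Periodic h (2 * Real.pi)) (θ s : ℝ) :
    h θ * Real.cos s + h' θ * Real.sin s ≤ h (θ + s) := by
  -- With `g t = h (θ + t) - h θ cos t - h' θ sin t`, this is `F = g' sin (s - t) + g cos (s - t)`,
  -- so `F' = (g + g'') sin (s - t)`, `F 0 = 0` and `F s = g s`.
  have hF : ∀ s t, HasDerivAt (fun t => (h' (θ + t) + h θ * Real.sin t - h' θ * Real.cos t) *
      Real.sin (s - t) + (h (θ + t) - h θ * Real.cos t - h' θ * Real.sin t) * Real.cos (s - t))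
      ((h (θ + t) + h'' (θ + t)) * Real.sin (s - t)) t := by
    intro s t
    have h1 := (hd (θ + t)).comp_const_add θ t
    have h2 := (hd' (θ + t)).comp_const_add θ t
    have h3 := (Real.hasDerivAt_sin (s - t)).comp t ((hasDerivAt_id t).const_sub s)
    have h4 := (Real.hasDerivAt_cos (s - t)).comp t ((hasDerivAt_id t).const_sub s)
    have h5 := ((h2.add ((Real.hasDerivAt_sin t).const_mul (h θ))).sub
      ((Real.hasDerivAt_cos t).const_mul (h' θ))).mul h3
    have h6 := ((h1.sub ((Real.hasDerivAt_cos t).const_mul (h θ))).sub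
      ((Real.hasDerivAt_sin t).const_mul (h' θ))).mul h4
    refine (h5.add h6).congr_deriv ?_
    simp only [Function.comp, Pi.add_apply, Pi.sub_apply]
    ring
  have hG : Function.Periodic (fun s => h (θ + s) - (h θ * Real.cos s + h' θ * Real.sin s))
      (2 * Real.pi) := by
    intro s
    simp only [← add_assoc, hp (θ + s), Real.cos_add_two_pi, Real.sin_add_two_pi]
  -- Within `(-π, π]` the factor `sin (y - t)` keeps one sign for `t` between `0` and `y`.
  obtain ⟨y, hy, e⟩ := hG.exists_mem_Ioc Real.two_pi_pos s (-Real.pi)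
  suffices h0 : 0 ≤ h (θ + y) - (h θ * Real.cos y + h' θ * Real.sin y) by linarith
  have hcont : Continuous _ := continuous_iff_continuousAt.2 fun t => (hF y t).continuousAt
  rcases le_total 0 y with h0 | h0
  · have := monotoneOn_of_deriv_nonneg (convex_Icc 0 y) hcont.continuousOn
      (fun t _ => (hF y t).differentiableAt.differentiableWithinAt) (fun t ht => by
        rw [(hF y t).deriv]
        rw [interior_Icc] at ht
        exact mul_nonneg (hnn _) (Real.sin_nonneg_of_nonneg_of_le_pi (by linarith [ht.2])
          (by linarith [ht.1, hy.2]))) (Set.left_mem_Icc.2 h0) (Set.right_mem_Icc.2 h0) h0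
    simp at this
    linarith
  · have := antitoneOn_of_deriv_nonpos (convex_Icc y 0) hcont.continuousOn
      (fun t _ => (hF y t).differentiableAt.differentiableWithinAt) (fun t ht => by
        rw [(hF y t).deriv]
        rw [interior_Icc] at ht
        exact mul_nonpos_of_nonneg_of_nonpos (hnn _) (Real.sin_nonpos_of_nonpos_of_neg_pi_le
          (by linarith [ht.1]) (by linarith [ht.2, hy.1])))
      (Set.left_mem_Icc.2 h0) (Set.right_mem_Icc.2 h0) h0
    simp at this
    linarith

theorem isSupportFunction_wulffShape (O : EuclideanSpace ℝ (Fin 2)) {h h' h'' : ℝ → ℝ}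
    (hd : ∀ x, HasDerivAt h (h' x) x)
    (hd' : ∀ x, HasDerivAt h' (h'' x) x) (hnn : ∀ x, 0 ≤ h x + h'' x)
    (hp : Function.Periodic h (2 * Real.pi)) : IsSupportFunction O (wulffShape O h) h := by
  intro θ
  have hin : ∀ η, inner ℝ (O + (h θ • dir θ + h' θ • dir (θ + Real.pi / 2)) - O) (dir η) =
      h θ * Real.cos (η - θ) + h' θ * Real.sin (η - θ) := by
    intro η
    rw [add_sub_cancel_left, inner_add_left, real_inner_smul_left, real_inner_smul_left,
      inner_dir_dir, inner_dir_dir, ← Real.cos_neg (θ - η), neg_sub, ← Real.cos_neg (θ + _ - η),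
      neg_sub, ← sub_sub, Real.cos_sub_pi_div_two]
  -- The witness is the envelope point of the lines `⟪x - O, dir θ⟫ = h θ`; the Sturm comparison
  -- places it in every half-plane.
  refine ⟨⟨O + (h θ • dir θ + h' θ • dir (θ + Real.pi / 2)), fun η => ?_, ?_⟩, ?_⟩
  · rw [hin]
    have := mul_cos_add_mul_sin_le hd hd' hnn hp θ (η - θ)
    rwa [add_sub_cancel] at this
  · exact (hin θ).trans (by simp)
  · rintro _ ⟨x, hx, rfl⟩
    exact hx θ

theorem isSupportFunction_unique {O : EuclideanSpace ℝ (Fin 2)}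
    {S : Set (EuclideanSpace ℝ (Fin 2))} {h g : ℝ → ℝ} (hh : IsSupportFunction O S h)
    (hg : IsSupportFunction O S g) : h = g :=
  funext fun θ => (hh θ).unique (hg θ)

theorem isSupportFunction_closedBall (O : EuclideanSpace ℝ (Fin 2)) {ρ : ℝ} (hρ : 0 ≤ ρ) :
    IsSupportFunction O (Metric.closedBall O ρ) fun _ => ρ := by
  intro θ
  refine ⟨⟨O + ρ • dir θ, ?_, ?_⟩, ?_⟩
  · rw [mem_closedBall_iff_norm, add_sub_cancel_left, norm_smul, norm_dir, mul_one,
      Real.norm_of_nonneg hρ]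
  · simp only [add_sub_cancel_left, real_inner_smul_left, inner_dir_dir, sub_self, Real.cos_zero,
      mul_one]
  · rintro _ ⟨x, hx, rfl⟩
    rw [mem_closedBall_iff_norm] at hx
    have := real_inner_le_norm (x - O) (dir θ)
    rw [norm_dir, mul_one] at this
    exact this.trans hx

/-! ### The one-parameter family of non-disk shapes. -/

/-- The half-length, in radians, of the arc cut off by the support line with normal `dir θ`. -/
noncomputable def arcProfile (α : ℝ) (q : ℕ) (ε θ : ℝ) : ℝ :=
  (Real.pi - α) / 2 + ε * Real.cos (q * θ)

/-- Since `q (π - α) = (q - p) π` is an odd multiple of `π`, the shift flips the sign of the cosine.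
-/
theorem arcProfile_add_arcProfile {α : ℝ} {p q : ℕ} (hpq : p < q) (hodd : Odd (q - p))
    (hα : α = (p : ℝ) / (q : ℝ) * Real.pi) (ε θ : ℝ) :
    arcProfile α q ε θ + arcProfile α q ε (θ + (Real.pi - α)) = Real.pi - α := by
  obtain ⟨m, hm⟩ := hodd
  have hq : (0 : ℝ) < q := by exact_mod_cast (Nat.zero_le p).trans_lt hpq
  have h1 : (q : ℝ) = p + (2 * m + 1) := by
    have : q = p + (2 * m + 1) := by omega
    exact_mod_cast this
  have h2 : (q : ℝ) * α = p * Real.pi := by rw [hα]; field_simp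
  have e : (q : ℝ) * (θ + (Real.pi - α)) = q * θ + Real.pi + m * (2 * Real.pi) := by
    linear_combination Real.pi * h1 - h2
  rw [arcProfile, arcProfile, e, Real.cos_add_nat_mul_two_pi, Real.cos_add_pi]
  ring

/-- The first two bounds keep `arcProfile` in `(0, π / 2)`, and `ε q` bounds its derivative. The
last expression is a lower bound for `(h + h'') / r`, positive at `ε = 0`. -/
theorem exists_pos_forall_curvature_pos {α : ℝ} (hα : 0 < α) (hαpi : α < Real.pi) (q : ℕ) :
    ∃ ε₀ > (0 : ℝ), ∀ ε ∈ Set.Ioo 0 ε₀, ε < (Real.pi - α) / 2 ∧ ε < α / 2 ∧ ε * q < 1 ∧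
      0 < Real.cos ((Real.pi - α) / 2 + ε) * (1 - (ε * q) ^ 2) - ε * q ^ 2 := by
  have hev : ∀ᶠ ε : ℝ in nhds 0, ε < (Real.pi - α) / 2 ∧ ε < α / 2 ∧ ε * q < 1 ∧
      0 < Real.cos ((Real.pi - α) / 2 + ε) * (1 - (ε * q) ^ 2) - ε * q ^ 2 := by
    refine (eventually_lt_nhds (by linarith)).and ((eventually_lt_nhds (by linarith)).and
      (.and ?_ ?_))
    · exact ContinuousAt.eventually_lt (f := fun ε : ℝ => ε * q) (by fun_prop)
        continuousAt_const (by simp)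
    · refine ContinuousAt.eventually_lt continuousAt_const (g := fun ε : ℝ =>
        Real.cos ((Real.pi - α) / 2 + ε) * (1 - (ε * q) ^ 2) - ε * q ^ 2) (by fun_prop) ?_
      have := Real.cos_pos_of_mem_Ioo (x := (Real.pi - α) / 2) ⟨by linarith, by linarith⟩
      simpa using this
  obtain ⟨ε₀, hε₀, h⟩ := Metric.eventually_nhds_iff.1 hev
  refine ⟨ε₀, hε₀, fun ε hε => h ?_⟩
  rw [Real.dist_0_eq_abs, abs_of_pos hε.1]
  exact hε.2

theorem arcProfile_mem_Icc (α : ℝ) (q : ℕ) {ε : ℝ} (hε : 0 ≤ ε) (θ : ℝ) :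
    arcProfile α q ε θ ∈ Set.Icc ((Real.pi - α) / 2 - ε) ((Real.pi - α) / 2 + ε) := by
  have h1 := Real.neg_one_le_cos (q * θ)
  have h2 := Real.cos_le_one (q * θ)
  constructor <;> rw [arcProfile] <;> nlinarith

theorem isSupportFunction_wulffShape_arcProfile (O : EuclideanSpace ℝ (Fin 2)) {r α ε : ℝ}
    (hr : 0 < r) {q : ℕ} (hε : 0 < ε) (h1 : ε < (Real.pi - α) / 2)
    (h2 : ε < α / 2) (h3 : ε * q < 1)
    (h4 : 0 < Real.cos ((Real.pi - α) / 2 + ε) * (1 - (ε * q) ^ 2) - ε * q ^ 2) :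
    IsSupportFunction O (wulffShape O fun θ => r * Real.cos (arcProfile α q ε θ))
      fun θ => r * Real.cos (arcProfile α q ε θ) := by
  have hlin : ∀ x : ℝ, HasDerivAt (fun θ : ℝ => (q : ℝ) * θ) q x := fun x => by
    simpa using (hasDerivAt_id x).const_mul (q : ℝ)
  have hw : ∀ x, HasDerivAt (arcProfile α q ε) (-(ε * q * Real.sin (q * x))) x := fun x => by
    refine ((((hlin x).cos).const_mul ε).const_add ((Real.pi - α) / 2)).congr_deriv ?_
    ring
  have hw' : ∀ x, HasDerivAt (fun x => -(ε * q * Real.sin (q * x)))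
      (-(ε * q ^ 2 * Real.cos (q * x))) x := fun x => by
    refine (((hlin x).sin).const_mul (ε * q)).neg.congr_deriv ?_
    ring
  refine isSupportFunction_wulffShape O (fun x => ((hw x).cos).const_mul r)
    (fun x => (((hw x).sin.neg).mul (hw' x)).const_mul r) (fun x => ?_) (fun x => ?_)
  · obtain ⟨hl, hu⟩ := arcProfile_mem_Icc α q hε.le x
    set w := arcProfile α q ε x
    have hcosw : Real.cos ((Real.pi - α) / 2 + ε) ≤ Real.cos w :=
      Real.cos_le_cos_of_nonneg_of_le_pi (by linarith) (by linarith) hu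
    have hc0 : 0 ≤ Real.cos ((Real.pi - α) / 2 + ε) :=
      Real.cos_nonneg_of_neg_pi_div_two_le_of_le (by linarith) (by linarith)
    have hs := Real.sin_sq_add_cos_sq (q * x)
    have hq0 : 0 ≤ ε * q := by positivity
    have hA : 0 ≤ 1 - (ε * q) ^ 2 := by nlinarith
    have hB : 1 - (ε * q) ^ 2 ≤ 1 - (ε * q * Real.sin (q * x)) ^ 2 := by
      nlinarith [mul_nonneg (sq_nonneg (ε * q)) (sq_nonneg (Real.cos (q * x)))]
    have hC : Real.cos ((Real.pi - α) / 2 + ε) * (1 - (ε * q) ^ 2) ≤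
        Real.cos w * (1 - (ε * q * Real.sin (q * x)) ^ 2) :=
      mul_le_mul hcosw hB hA (hc0.trans hcosw)
    have hD : -(1 : ℝ) ≤ Real.sin w * Real.cos (q * x) := by
      nlinarith [sq_nonneg (Real.sin w + Real.cos (q * x)), Real.sin_sq_le_one w,
        Real.cos_sq_le_one (q * x)]
    have hE : -(ε * q ^ 2) ≤ ε * q ^ 2 * (Real.sin w * Real.cos (q * x)) := by
      nlinarith [mul_le_mul_of_nonneg_left hD (by positivity : 0 ≤ ε * (q : ℝ) ^ 2)]
    calc 0 ≤ r * (Real.cos w * (1 - (ε * q * Real.sin (q * x)) ^ 2) +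
          ε * q ^ 2 * (Real.sin w * Real.cos (q * x))) := mul_nonneg hr.le (by linarith)
      _ = _ := by simp only [Pi.neg_apply]; ring
  · have e : (q : ℝ) * (x + 2 * Real.pi) = q * x + q * (2 * Real.pi) := by ring
    simp only [arcProfile]
    rw [e, Real.cos_add_nat_mul_two_pi]

theorem wulffShape_arcProfile_mem (O : EuclideanSpace ℝ (Fin 2)) {r α ε : ℝ}
    (hr : 0 < r) (hα : 0 < α) {p q : ℕ} (hpq : p < q) (hodd : Odd (q - p))
    (hαe : α = (p : ℝ) / (q : ℝ) * Real.pi) (hε : 0 < ε) (h1 : ε < (Real.pi - α) / 2)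
    (h2 : ε < α / 2)
    (hsupp : IsSupportFunction O (wulffShape O fun θ => r * Real.cos (arcProfile α q ε θ))
      fun θ => r * Real.cos (arcProfile α q ε θ)) :
    (wulffShape O fun θ => r * Real.cos (arcProfile α q ε θ)) ∈
      nonDiskConstantAngleShapes O r α := by
  have hq : (0 : ℝ) < q := by exact_mod_cast (Nat.zero_le p).trans_lt hpq
  have hmem : ∀ θ, arcProfile α q ε θ ∈ Set.Ioo 0 Real.pi := by
    intro θ
    obtain ⟨hl, hu⟩ := arcProfile_mem_Icc α q hε.le θ
    exact ⟨by linarith, by linarith⟩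
  have hlt : ∀ θ, r * Real.cos (arcProfile α q ε θ) < r := by
    intro θ
    have := Real.cos_lt_cos_of_nonneg_of_le_pi le_rfl (hmem θ).2.le (hmem θ).1
    rw [Real.cos_zero] at this
    nlinarith
  refine ⟨isConstantAngleShape_of_isSupportFunction hr hα (isCompact_wulffShape hr hlt)
    (convex_wulffShape O _) (wulffShape_subset_ball hr hlt)
    (by unfold arcProfile; fun_prop) hmem hsupp (arcProfile_add_arcProfile hpq hodd hαe ε), ?_⟩
  intro ρ hρ
  rw [hρ] at hsupp
  have hρ0 : 0 ≤ ρ := by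
    obtain ⟨x, hx, -⟩ := (hsupp 0).1
    exact dist_nonneg.trans hx
  have hconst := isSupportFunction_unique hsupp (isSupportFunction_closedBall O hρ0)
  have hc0 := congrFun hconst 0
  -- At `0` and `π / q` the cosine is `1` and `-1`, so a constant support function would force `ε =
  -- 0`.
  have hc1 := congrFun hconst (Real.pi / q)
  have heq := Real.injOn_cos (Set.Ioo_subset_Icc_self (hmem 0))
    (Set.Ioo_subset_Icc_self (hmem (Real.pi / q))) (mul_left_cancel₀ hr.ne' (hc0.trans hc1.symm))
  rw [arcProfile, arcProfile, mul_zero, Real.cos_zero, mul_div_cancel₀ _ hq.ne', Real.cos_pi]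
    at heq
  linarith

theorem IsOddDifferenceAngle.not_countable {O : EuclideanSpace ℝ (Fin 2)} {r α : ℝ}
    (hr : 0 < r) (hα : 0 < α) (hαpi : α < Real.pi) (h : IsOddDifferenceAngle α) :
    ¬ (nonDiskConstantAngleShapes O r α).Countable := by
  obtain ⟨p, q, -, hpq, -, hodd, hαe⟩ := h
  obtain ⟨ε₀, hε₀, hsmall⟩ := exists_pos_forall_curvature_pos hα hαpi q
  have hsupp : ∀ ε ∈ Set.Ioo 0 ε₀, IsSupportFunction O
      (wulffShape O fun θ => r * Real.cos (arcProfile α q ε θ))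
      fun θ => r * Real.cos (arcProfile α q ε θ) := by
    intro ε hε
    obtain ⟨h1, h2, h3, h4⟩ := hsmall ε hε
    exact isSupportFunction_wulffShape_arcProfile O hr hε.1 h1 h2 h3 h4
  intro hcount
  have hmaps : Set.MapsTo (fun ε => wulffShape O fun θ => r * Real.cos (arcProfile α q ε θ))
      (Set.Ioo 0 ε₀) (nonDiskConstantAngleShapes O r α) := by
    intro ε hε
    obtain ⟨h1, h2, -, -⟩ := hsmall ε hε
    exact wulffShape_arcProfile_mem O hr hα hpq hodd hαe hε.1 h1 h2 (hsupp ε hε)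
  have hinj : Set.InjOn (fun ε => wulffShape O fun θ => r * Real.cos (arcProfile α q ε θ))
      (Set.Ioo 0 ε₀) := by
    intro ε hε δ hδ e
    simp only at e
    obtain ⟨h1, h2, -, -⟩ := hsmall ε hε
    obtain ⟨h1', h2', -, -⟩ := hsmall δ hδ
    have hs := hsupp ε hε
    rw [e] at hs
    -- The support value `r cos ((π - α) / 2 + ε)` at angle `0` already determines `ε`.
    have h0 := congrFun (isSupportFunction_unique hs (hsupp δ hδ)) 0
    simp only [arcProfile, mul_zero, Real.cos_zero, mul_one] at h0
    have := Real.injOn_cos ⟨by linarith [hε.1], by linarith⟩ ⟨by linarith [hδ.1], by linarith⟩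
      (mul_left_cancel₀ hr.ne' h0)
    linarith
  have := Cardinal.Real.Ioo_countable_iff.1 (hmaps.countable_of_injOn hinj hcount)
  linarith

theorem theorem1 (O : EuclideanSpace ℝ (Fin 2)) (r : ℝ) (hr : 0 < r)
    (α : ℝ) (hα0 : 0 < α) (hαpi : α < Real.pi) :
    ((nonDiskConstantAngleShapes O r α).Nonempty ↔ IsOddDifferenceAngle α) ∧
      (IsOddDifferenceAngle α → ¬ (nonDiskConstantAngleShapes O r α).Countable) := by
  refine ⟨⟨?_, fun h => ?_⟩, fun h => h.not_countable hr hα0 hαpi⟩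
  · rintro ⟨S, hS, hdisk⟩
    by_contra hn
    obtain ⟨ρ, hρ⟩ := hS.eq_closedBall hr hα0 hαpi hn
    exact hdisk ρ hρ
  · by_contra hne
    rw [Set.not_nonempty_iff_eq_empty] at hne
    exact h.not_countable (O := O) hr hα0 hαpi (hne ▸ Set.countable_empty)
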